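/- **Model.** Let $d\ge 1$, and let $L,r,s$ be positive integers with $r-s>1$ and $L\ge 2r$. The $d$-dimensional lattice consists of the $n=L^d$ nodes $\{0,\dots,L-1\}^d\subset\mathbb R^d$. Two nodes are neighbours if their Euclidean distance is greater than $s$ and at most $r$. In a synchronous round each node is a sender or a receiver; a node receives the message in a round if and only if it is not a sender, exactly one of its neighbours is a sender, and no node within distance $s$ of it is a sender. Initially only the source has the message. An algorithm schedules a set of nodes for each round; the scheduled nodes that have the message send it. **Algorithm $\mathcal A$** on a line $0,\dots,L-1$ with source $c$. Put $w=r-(s+1)$, $x=\lceil r/w\rceil$ and $q=c \bmod r$. The scheme $Local^*_k$ has steps $i=0,\dots,x$ of two rounds each: first node $k+iw$ is scheduled, then node $k+iw+r$ (nodes outside the line do not exist). $\mathcal A$ consists of, in this order: (1) the nodes $c,c+r,c+2r,\dots$ and then $c-r,c-2r,\dots$ of the line, one per round; (2) $Local^*_k$ in parallel for $k=q,q+4r,q+8r,\dots$, and then in parallel for $k=q+2r,q+6r,\dots$; (3) the mirror image of $Local^*$ starting at $2r-1$ (nodes $2r-1-iw$, then $r-1-iw$), and then $Local^*_{L-2r}$.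 **Algorithm $\mathcal A^d$** with source $v^0$ has stages $j=0,\dots,d-1$. Stage $0$ executes $\mathcal A$ on the line through $v^0$ parallel to the first axis (coordinate $0$). For $j\ge1$ let $h_j=\lfloor \sqrt3\,r/(2\sqrt j)\rfloor$, and consider the transversal values $h_j,3h_j,5h_j,\dots$ (all of $0,1,\dots,L-1$ if $h_j=0$) up to $L-1$, followed by $L-1$ if it is not among them; number them consecutively from $0$ and divide them into $3j$ classes by their number modulo $3j$. Stage $j$ has $(3j)^j$ phases, one for each choice of a class for each of the coordinates $0,\dots,j-1$; in a phase $\mathcal A$ is executed simultaneously, with source coordinate $v^0_j$, on all lines parallel to axis $j$ whose coordinates $l<j$ lie in the chosen classes and whose coordinates $l>j$ equal $v^0_l$. **Lemma.** For every fixed $d$, Algorithm $\mathcal A^d$ broadcasts in the $d$-dimensional lattice with time complexity in $$\Theta\!\left(d\,\frac{\sqrt[d]{n}}{r}+d\,\frac{r}{r-(s+1)}\right).$$ That is, for every $d\ge1$ there are constants $c,C>0$ depending only on $d$ such that for all $L,r,s$ as above, $n=L^d$, and every source node: all nodes have received the message at the end of $\mathcal A^d$; the number of rounds of $\mathcal A^d$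 is at most $C\,(d\sqrt[d]{n}/r+d\,r/(r-(s+1)))$; and if all nodes have received the message after the first $t$ rounds of $\mathcal A^d$, then $t\ge c\,(d\sqrt[d]{n}/r+d\,r/(r-(s+1)))$. -/

import Mathlib

/-! ### The swamping communication model on the `d`-dimensional lattice -/

/-- The nodes of the `d`-dimensional lattice of side `L`; there are `L ^ d` of them. -/
abbrev LatticeNode (d L : ℕ) : Type := Fin d → Fin L

/-- The location of a node: the integer point of Euclidean space with the same coordinates. -/
noncomputable def LatticeNode.pos {d L : ℕ} (u : LatticeNode d L) : EuclideanSpace ℝ (Fin d) :=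
  WithLp.toLp 2 fun i => ((u i : ℕ) : ℝ)

/-- The communication graph: two nodes share a link when their Euclidean distance is greater than
the swamping distance `s` and at most the communication range `r`. -/
def swampGraph (d L r s : ℕ) : SimpleGraph (LatticeNode d L) where
  Adj u v := (s : ℝ) < dist u.pos v.pos ∧ dist u.pos v.pos ≤ (r : ℝ)
  symm := ⟨fun u v h => by rwa [dist_comm v.pos u.pos]⟩
  loopless := ⟨fun u h => by
    have h1 := h.1
    rw [dist_self] at h1
    exact absurd h1 (not_lt.mpr (Nat.cast_nonneg s))⟩

/-- If `X` is the set of senders of a round, `v` receives the message in that round iff it is not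
itself a sender, exactly one of its neighbours is a sender, and no node within distance `s` of it
is a sender. -/
def Receives {d L : ℕ} (r s : ℕ) (X : Set (LatticeNode d L)) (v : LatticeNode d L) : Prop :=
  v ∉ X ∧ (∃! u, u ∈ X ∧ (swampGraph d L r s).Adj u v) ∧
    ∀ u ∈ X, ¬ dist u.pos v.pos ≤ (s : ℝ)

/-- The nodes that possess the message of the source `src` after the first `t` rounds of a
schedule. In each round the scheduled nodes send the message, provided that they possess it; all
other nodes listen. No node sends once the schedule is over. -/
def informed {d L : ℕ} (r s : ℕ) (sched : List (Set (LatticeNode d L))) (src : LatticeNode d L) :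
    ℕ → Set (LatticeNode d L)
  | 0 => {src}
  | t + 1 => informed r s sched src t ∪
      {v | Receives r s (sched.getD t ∅ ∩ informed r s sched src t) v}

/-! ### Algorithm `A` on the lattice line

A round is given by the set of labels that are scheduled to send; labels that lie outside the
line `0, …, L - 1` belong to no node. -/

/-- The scheme `Local*`, run in parallel from all labels `k ∈ K`. It has `⌈r / (r - (s+1))⌉ + 1`
steps of two rounds: in step `i` first the node at `k + i (r - (s+1))` sends, then the node at
distance `r` further. For `ε = 1` the scheme runs to the right; `ε = -1` is its mirror image. -/
def localScheme (r s : ℕ) (ε : ℤ) (K : Set ℤ) : List (Set ℤ) :=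
  (List.range (r ⌈/⌉ (r - (s + 1)) + 1)).flatMap fun i =>
    [{y | ∃ k ∈ K, y = k + ε * ((i * (r - (s + 1)) : ℕ) : ℤ)},
     {y | ∃ k ∈ K, y = k + ε * ((i * (r - (s + 1)) + r : ℕ) : ℤ)}]

/-- The sparse transmission from label `c`: the labels `c, c + r, c + 2r, …` send one after
another, then the labels `c - r, c - 2r, …`. -/
def sparsePart (L r c : ℕ) : List (Set ℤ) :=
  ((List.range ((L - 1 - c) / r + 1)).map fun j => {((c + j * r : ℕ) : ℤ)}) ++
    ((List.range (c / r)).map fun j => {(c : ℤ) - (((j + 1) * r : ℕ) : ℤ)})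

/-- Algorithm `A` on the line `0, …, L - 1` with source `c`: the sparse transmission; then `Local*`
in parallel from `q, q + 4r, q + 8r, …`, and from `q + 2r, q + 6r, …`, where `q = c % r` is the
leftmost label reached by the sparse transmission; then the termination at the left end (mirrored
`Local*` on the first `2r` labels) and at the right end (`Local*` on the last `2r` labels). -/
def algA (L r s c : ℕ) : List (Set ℤ) :=
  sparsePart L r c ++
    localScheme r s 1 {k | ∃ j : ℕ, k = ((c % r + 4 * r * j : ℕ) : ℤ)} ++
    localScheme r s 1 {k | ∃ j : ℕ, k = ((c % r + 2 * r + 4 * r * j : ℕ) : ℤ)} ++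
    localScheme r s (-1) {2 * (r : ℤ) - 1} ++
    localScheme r s 1 {(L : ℤ) - 2 * (r : ℤ)}

/-! ### Algorithm `A^d` -/

/-- `⌊√3 r / (2 √j)⌋`. A node whose first `j` coordinates differ by at most this number from those
of a line parallel to the next axis has distance at most `√3 r / 2` from that line. -/
def halfGap (r j : ℕ) : ℕ := Nat.sqrt (3 * r ^ 2 / (4 * j))

/-- With `h = halfGap r j`, the lines of a stage have transversal coordinates `h, 3h, 5h, …` (all
of `0, 1, 2, …` if `h = 0`), where the first of these numbers beyond the last coordinate `L - 1`,
if it is needed, is replaced by `L - 1`. They are split cyclically into `3j` classes; this is the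
class `e`. -/
def lineCoords (L r j e : ℕ) : Set ℕ :=
  {z | ∃ m : ℕ, m % (3 * j) = e ∧
    halfGap r j + max 1 (2 * halfGap r j) * m < L - 1 + max 1 (2 * halfGap r j) ∧
    z = min (halfGap r j + max 1 (2 * halfGap r j) * m) (L - 1)}

/-- Algorithm `A^d`. In stage `j = 0, …, d - 1` Algorithm `A` is executed on lines parallel to
axis `j`, inside the sublattice of the nodes that agree with the source in all coordinates after
`j`. A stage has `(3j)^j` phases, one for each choice of a class in every transversal coordinate
`l < j` (the digits of `e` in base `3j`); in a phase, `A` runs simultaneously on all the lines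
whose transversal coordinates are in the chosen classes. Stage `0` is one execution of `A` on the
line of the source, and stage `1` has three phases, on the lines at
`h, 7h, 13h, …`, at `3h, 9h, 15h, …` and at `5h, 11h, 17h, …`. -/
def algAd (d L r s : ℕ) (src : LatticeNode d L) : List (Set (LatticeNode d L)) :=
  (List.finRange d).flatMap fun j : Fin d =>
    (List.range ((3 * (j : ℕ)) ^ (j : ℕ))).flatMap fun e =>
      (algA L r s (src j)).map fun S =>
        {v | ((v j : ℕ) : ℤ) ∈ S ∧
          (∀ l : Fin d, l < j →
            ((v l : ℕ) ∈ lineCoords L r j (e / (3 * (j : ℕ)) ^ (l : ℕ) % (3 * (j : ℕ))))) ∧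
          ∀ l : Fin d, j < l → v l = src l}

/-!
At squared distance `D` from the line of a sender, the sender is heard on an annulus of labels. For
`D ≤ 3 r ^ 2 / 4` the annulus reaches at least `(r - 1) / 2` labels far, and it is either a full
disc or has width at least `r - (s + 1)`, the step length of `Local*`. Hence the annuli of one
execution of `Local*` cover `2r` consecutive labels, shifted by a margin that only depends on `D`.
The shift is the same for all starting labels `q, q + 2r, q + 4r, …`, so nothing is missed between
them, and the margins at the two ends of the line are repaired by the two closing schemes. Every
node that agrees with the source in all coordinates after `j` has squared distance at most
`3 r ^ 2 / 4` from a line of stage `j`, so the stages fill larger and larger sublattices.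

For the lower bound, the message advances by at most `r` along an axis per round, and the node with
label `c % r + s` on the line of a source with label `c` has no scheduled neighbour until `Local*`
has advanced from `c % r` by about `s`.
-/

namespace LatticeNode

variable {d L : ℕ}

/-- The squared Euclidean distance of two nodes, as a natural number, so that it can be compared
with `r ^ 2` and `s ^ 2` by integer arithmetic. -/
def sqDist (u v : LatticeNode d L) : ℕ := ∑ l, ((u l : ℤ) - (v l : ℤ)).natAbs ^ 2

/-- The nodes on the line through `b` parallel to axis `j`. -/
def axisLine (j : Fin d) (b : LatticeNode d L) : Set (LatticeNode d L) :=
  {u | ∀ l, l ≠ j → u l = b l}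

/-- The squared Euclidean distance of `v` from the line through `b` parallel to axis `j`, where the
line is taken to extend beyond the lattice. -/
def sqDistLine (j : Fin d) (b v : LatticeNode d L) : ℕ :=
  ∑ l ∈ Finset.univ.erase j, ((b l : ℤ) - (v l : ℤ)).natAbs ^ 2

lemma dist_pos_eq_sqrt (u v : LatticeNode d L) :
    dist u.pos v.pos = Real.sqrt (sqDist u v) := by
  rw [EuclideanSpace.dist_eq]
  simp [sqDist, pos, Real.dist_eq, sq_abs]

lemma dist_pos_le_iff {u v : LatticeNode d L} {r : ℕ} :
    dist u.pos v.pos ≤ r ↔ sqDist u v ≤ r ^ 2 := by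
  rw [dist_pos_eq_sqrt, Real.sqrt_le_left (Nat.cast_nonneg r)]
  exact_mod_cast Iff.rfl

lemma natAbs_sub_le_of_dist_pos_le {u v : LatticeNode d L} {r : ℕ} (h : dist u.pos v.pos ≤ r)
    (l : Fin d) : ((u l : ℤ) - (v l : ℤ)).natAbs ≤ r := by
  have hl : ((u l : ℤ) - (v l : ℤ)).natAbs ^ 2 ≤ sqDist u v :=
    Finset.single_le_sum (f := fun l => ((u l : ℤ) - (v l : ℤ)).natAbs ^ 2)
      (fun _ _ => Nat.zero_le _) (Finset.mem_univ l)
  exact (Nat.pow_le_pow_iff_left two_ne_zero).1 (hl.trans (dist_pos_le_iff.1 h))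

lemma lt_dist_pos_of_lt_natAbs_sub {u v : LatticeNode d L} {r : ℕ} {l : Fin d}
    (h : r < ((u l : ℤ) - (v l : ℤ)).natAbs) : (r : ℝ) < dist u.pos v.pos := by
  contrapose! h
  exact natAbs_sub_le_of_dist_pos_le h l

lemma sqDist_eq_add_sqDistLine {j : Fin d} {u b : LatticeNode d L} (hu : u ∈ axisLine j b)
    (v : LatticeNode d L) :
    sqDist u v = ((u j : ℤ) - (v j : ℤ)).natAbs ^ 2 + sqDistLine j b v := by
  rw [sqDist, ← Finset.add_sum_erase _ _ (Finset.mem_univ j), sqDistLine]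
  congr 1
  exact Finset.sum_congr rfl fun l hl => by rw [hu l (Finset.ne_of_mem_erase hl)]

lemma sqDistLine_eq_zero {j : Fin d} {b v : LatticeNode d L} (hv : v ∈ axisLine j b) :
    sqDistLine j b v = 0 :=
  Finset.sum_eq_zero fun l hl => by simp [hv l (Finset.ne_of_mem_erase hl)]

lemma exists_mem_axisLine (j : Fin d) (b : LatticeNode d L) {a : ℤ}
    (ha : a ∈ Set.Ico (0 : ℤ) L) : ∃ u ∈ axisLine j b, (u j : ℤ) = a := by
  obtain ⟨h0, hL⟩ := ha
  lift a to ℕ using h0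
  exact ⟨Function.update b j ⟨a, by omega⟩, fun l hl => Function.update_of_ne hl _ _, by simp⟩

end LatticeNode

open LatticeNode

section Communication

variable {d L r s : ℕ}

lemma swampGraph_adj_iff {u v : LatticeNode d L} :
    (swampGraph d L r s).Adj u v ↔ s ^ 2 < sqDist u v ∧ sqDist u v ≤ r ^ 2 := by
  change (s : ℝ) < dist u.pos v.pos ∧ dist u.pos v.pos ≤ (r : ℝ) ↔ _
  rw [← not_le, dist_pos_le_iff, dist_pos_le_iff, not_le]

lemma swampGraph_adj_iff_of_mem_axisLine {j : Fin d} {u v : LatticeNode d L}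
    (hu : u ∈ axisLine j v) :
    (swampGraph d L r s).Adj u v ↔
      s < ((u j : ℤ) - (v j : ℤ)).natAbs ∧ ((u j : ℤ) - (v j : ℤ)).natAbs ≤ r := by
  rw [swampGraph_adj_iff, sqDist_eq_add_sqDistLine hu, sqDistLine_eq_zero fun _ _ => rfl,
    add_zero, Nat.pow_lt_pow_iff_left two_ne_zero, Nat.pow_le_pow_iff_left two_ne_zero]

/-- The nodes that possess the message after a schedule has been executed from the state in which
exactly the nodes of `I` possess it; unlike `informed`, this composes along concatenation. -/
def informedFrom (r s : ℕ) (sched : List (Set (LatticeNode d L))) (I : Set (LatticeNode d L)) :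
    Set (LatticeNode d L) :=
  sched.foldl (fun J X => J ∪ {v | Receives r s (X ∩ J) v}) I

lemma informedFrom_append (sched sched' : List (Set (LatticeNode d L)))
    (I : Set (LatticeNode d L)) :
    informedFrom r s (sched ++ sched') I = informedFrom r s sched' (informedFrom r s sched I) :=
  List.foldl_append

lemma subset_informedFrom (sched : List (Set (LatticeNode d L))) (I : Set (LatticeNode d L)) :
    I ⊆ informedFrom r s sched I := by
  induction sched generalizing I with
  | nil => exact subset_rfl
  | cons X sched ih => exact Set.subset_union_left.trans (ih _)

lemma informed_eq_informedFrom_take {sched : List (Set (LatticeNode d L))} (src : LatticeNode d L)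
    {t : ℕ} (ht : t ≤ sched.length) :
    informed r s sched src t = informedFrom r s (sched.take t) {src} := by
  induction t with
  | zero => rfl
  | succ t ih =>
    have hlt : t < sched.length := ht
    rw [← List.take_concat_get' _ _ hlt, informedFrom_append, ← ih hlt.le]
    simp only [informed, informedFrom, List.foldl_cons, List.foldl_nil]
    rw [List.getD_eq_getElem _ _ hlt]

lemma informed_length (sched : List (Set (LatticeNode d L))) (src : LatticeNode d L) :
    informed r s sched src sched.length = informedFrom r s sched {src} := by
  rw [informed_eq_informedFrom_take _ le_rfl, List.take_length]

/-- By the triangle inequality no two of the senders are within distance `r` of the same node. -/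
lemma receives_of_pairwise_far {X : Set (LatticeNode d L)} {u v : LatticeNode d L}
    (hX : X.Pairwise fun u u' => 2 * (r : ℝ) < dist u.pos u'.pos) (hu : u ∈ X)
    (huv : (swampGraph d L r s).Adj u v) : Receives r s X v := by
  obtain ⟨hs, hr⟩ := huv
  have eq_of_near : ∀ u' ∈ X, dist u'.pos v.pos ≤ (r : ℝ) → u' = u := fun u' hu' h => by
    by_contra hne
    linarith [hX hu' hu hne, dist_triangle_right u'.pos u.pos v.pos]
  have not_swamped : ∀ u' ∈ X, ¬ dist u'.pos v.pos ≤ (s : ℝ) := fun u' hu' h => by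
    rw [eq_of_near u' hu' (h.trans (hs.le.trans hr))] at h
    exact h.not_gt hs
  refine ⟨fun hv => not_swamped v hv ?_, ⟨u, ⟨hu, hs, hr⟩, fun u' h => ?_⟩, not_swamped⟩
  · rw [dist_self]
    exact Nat.cast_nonneg s
  · exact eq_of_near u' h.1 h.2.2

lemma notMem_informedFrom {sched : List (Set (LatticeNode d L))} {I : Set (LatticeNode d L)}
    {v : LatticeNode d L} (hv : v ∉ I)
    (hadj : ∀ X ∈ sched, ∀ u ∈ X, ¬ (swampGraph d L r s).Adj u v) :
    v ∉ informedFrom r s sched I := by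
  induction sched generalizing I with
  | nil => exact hv
  | cons X sched ih =>
    refine ih (fun hv' => ?_) fun Y hY => hadj Y (List.mem_cons_of_mem _ hY)
    rcases hv' with hv' | ⟨_, ⟨u, ⟨hu, huv⟩, _⟩, _⟩
    · exact hv hv'
    · exact hadj X List.mem_cons_self u hu.1 huv

lemma notMem_informed_append {sched rest : List (Set (LatticeNode d L))}
    {src v : LatticeNode d L} {t : ℕ} (ht : t ≤ sched.length) (hv : v ≠ src)
    (hadj : ∀ X ∈ sched, ∀ u ∈ X, ¬ (swampGraph d L r s).Adj u v) :
    v ∉ informed r s (sched ++ rest) src t := by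
  rw [informed_eq_informedFrom_take _ (by rw [List.length_append]; omega),
    List.take_append_of_le_length ht]
  exact notMem_informedFrom hv fun X hX => hadj X (List.mem_of_mem_take hX)

lemma natAbs_sub_le_of_mem_informed {sched : List (Set (LatticeNode d L))}
    {src v : LatticeNode d L} {t : ℕ} (hv : v ∈ informed r s sched src t) (l : Fin d) :
    ((v l : ℤ) - (src l : ℤ)).natAbs ≤ t * r := by
  induction t generalizing v with
  | zero =>
    obtain rfl : v = src := hv
    simp
  | succ t ih =>
    rw [add_one_mul]
    rcases hv with hv | ⟨_, ⟨u, ⟨hu, huv⟩, _⟩, _⟩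
    · exact (ih hv).trans (Nat.le_add_right _ _)
    · have := ih hu.2
      have := natAbs_sub_le_of_dist_pos_le huv.2 l
      omega

end Communication

section Lines

variable {d L r s : ℕ} {j : Fin d}

/-- A set of labels of which any two differ by more than `2r`, so that senders at these labels of a
line do not interfere. -/
def IsSparse (r : ℕ) (S : Set ℤ) : Prop := S.Pairwise fun a a' => 2 * r < (a - a').natAbs

/-- The set `F` is a union of lines parallel to axis `j`, and points of different lines are further
apart than `2r`, so that an algorithm can be executed on all of them simultaneously. -/
structure IsLineFamily (r : ℕ) (j : Fin d) (F : Set (LatticeNode d L)) : Prop where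
  axisLine_subset : ∀ b ∈ F, axisLine j b ⊆ F
  mem_axisLine_or_far : ∀ u ∈ F, ∀ u' ∈ F,
    u ∈ axisLine j u' ∨ 2 * (r : ℝ) < dist u.pos u'.pos

/-- The nodes of `F` whose label along axis `j` is in `S`. -/
def onLines (j : Fin d) (F : Set (LatticeNode d L)) (S : Set ℤ) : Set (LatticeNode d L) :=
  {v | ((v j : ℕ) : ℤ) ∈ S ∧ v ∈ F}

/-- The nodes that possess the message after a schedule of labels has been executed simultaneously
on the lines of `F`, starting from the state `I`. -/
def lineRun (r s : ℕ) (j : Fin d) (F : Set (LatticeNode d L)) (sched : List (Set ℤ))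
    (I : Set (LatticeNode d L)) : Set (LatticeNode d L) :=
  informedFrom r s (sched.map (onLines j F)) I

/-- The node with label `a` on the line through `b` parallel to axis `j` is in `I`. This holds by
convention if `a` is not the label of a node. -/
def Known (j : Fin d) (b : LatticeNode d L) (I : Set (LatticeNode d L)) (a : ℤ) : Prop :=
  ∀ u ∈ axisLine j b, (u j : ℤ) = a → u ∈ I

/-- All neighbours of the node with label `a` on the line through `b` parallel to axis `j` are in
`I`. This holds by convention if `a` is not the label of a node. -/
def Served (r s : ℕ) (j : Fin d) (b : LatticeNode d L) (I : Set (LatticeNode d L)) (a : ℤ) :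
    Prop :=
  ∀ u ∈ axisLine j b, (u j : ℤ) = a → ∀ v, (swampGraph d L r s).Adj u v → v ∈ I

variable {F I I' : Set (LatticeNode d L)} {b : LatticeNode d L} {a : ℤ}

lemma isSparse_singleton (r : ℕ) (a : ℤ) : IsSparse r {a} := Set.pairwise_singleton _ _

lemma lineRun_append (sched sched' : List (Set ℤ)) (I : Set (LatticeNode d L)) :
    lineRun r s j F (sched ++ sched') I = lineRun r s j F sched' (lineRun r s j F sched I) := by
  rw [lineRun, List.map_append, informedFrom_append]
  rfl

lemma subset_lineRun (sched : List (Set ℤ)) (I : Set (LatticeNode d L)) :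
    I ⊆ lineRun r s j F sched I :=
  subset_informedFrom _ _

lemma Known.mono (h : Known j b I a) (hI : I ⊆ I') : Known j b I' a :=
  fun u hu ha => hI (h u hu ha)

lemma Served.mono (h : Served r s j b I a) (hI : I ⊆ I') : Served r s j b I' a :=
  fun u hu ha v hv => hI (h u hu ha v hv)

lemma Served.mem (h : Served r s j b I a) (ha : a ∈ Set.Ico (0 : ℤ) L) {v : LatticeNode d L}
    (hs : s ^ 2 < (a - (v j : ℤ)).natAbs ^ 2 + sqDistLine j b v)
    (hr : (a - (v j : ℤ)).natAbs ^ 2 + sqDistLine j b v ≤ r ^ 2) : v ∈ I := by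
  obtain ⟨u, hu, rfl⟩ := exists_mem_axisLine j b ha
  rw [← sqDist_eq_add_sqDistLine hu] at hs hr
  exact h u hu rfl v (swampGraph_adj_iff.2 ⟨hs, hr⟩)

lemma Served.known (h : Served r s j b I a) (ha : a ∈ Set.Ico (0 : ℤ) L) {y : ℤ}
    (hs : s < (a - y).natAbs) (hr : (a - y).natAbs ≤ r) : Known j b I y := by
  rintro v hv rfl
  obtain ⟨u, hu, rfl⟩ := exists_mem_axisLine j b ha
  have huv : u ∈ axisLine j v := fun l hl => (hu l hl).trans (hv l hl).symm
  exact h u hu rfl v ((swampGraph_adj_iff_of_mem_axisLine huv).2 ⟨hs, hr⟩)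

lemma IsLineFamily.pairwise_far_onLines (hF : IsLineFamily r j F) {S : Set ℤ}
    (hS : IsSparse r S) :
    (onLines j F S).Pairwise fun u u' => 2 * (r : ℝ) < dist u.pos u'.pos := by
  intro u hu u' hu' hne
  refine (hF.mem_axisLine_or_far u hu.2 u' hu'.2).elim (fun hline => ?_) id
  have hlabel : ((u j : ℕ) : ℤ) ≠ (u' j : ℕ) := fun heq => hne <| funext fun l => by
    by_cases hl : l = j
    · subst hl
      exact Fin.ext (by exact_mod_cast heq)
    · exact hline l hl
  exact_mod_cast lt_dist_pos_of_lt_natAbs_sub (hS hu.1 hu'.1 hlabel)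

lemma Known.served_lineRun (hF : IsLineFamily r j F) (hb : b ∈ F) {S : Set ℤ} (hS : IsSparse r S)
    (haS : a ∈ S) (ha : Known j b I a) : Served r s j b (lineRun r s j F [S] I) a := by
  rintro u hu rfl v huv
  have hX := (hF.pairwise_far_onLines hS).mono (Set.inter_subset_left (t := I))
  exact Or.inr (receives_of_pairwise_far hX
    ⟨⟨haS, hF.axisLine_subset b hb hu⟩, ha u hu rfl⟩ huv)

end Lines

section Reception

variable {r s w D : ℕ}

/-- A transmission is received at squared distance `D` from the line of the sender exactly at the
labels whose distance `δ` from the label of the sender satisfies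
`innerRadius s D ≤ δ ≤ outerRadius r D`. This is the inner radius. -/
def innerRadius (s D : ℕ) : ℕ := if D ≤ s ^ 2 then Nat.sqrt (s ^ 2 - D) + 1 else 0

/-- The largest distance along a line of labels at which a transmission is received at squared
distance `D ≤ r ^ 2` from the line; see `innerRadius`. -/
def outerRadius (r D : ℕ) : ℕ := Nat.sqrt (r ^ 2 - D)

/-- The transmissions of `Local*` at the labels `0, …, 2r - 1` of a line are received at squared
distance `D` from the line on `2r` consecutive labels, of which this is the first. -/
def margin (r s D : ℕ) : ℕ := min (innerRadius s D) (r - outerRadius r D)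

lemma innerRadius_le_iff {δ : ℕ} : innerRadius s D ≤ δ ↔ s ^ 2 < δ ^ 2 + D := by
  unfold innerRadius
  split_ifs with h
  · rw [Nat.succ_le_iff, Nat.sqrt_lt']
    omega
  · omega

lemma le_outerRadius_iff (hD : D ≤ r ^ 2) {δ : ℕ} : δ ≤ outerRadius r D ↔ δ ^ 2 + D ≤ r ^ 2 := by
  rw [outerRadius, Nat.le_sqrt']
  omega

lemma outerRadius_le (r D : ℕ) : outerRadius r D ≤ r :=
  (Nat.sqrt_le_sqrt (Nat.sub_le _ _)).trans_eq (Nat.sqrt_eq' r)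

lemma le_two_mul_outerRadius_add_one (hD : 4 * D ≤ 3 * r ^ 2) : r ≤ 2 * outerRadius r D + 1 := by
  by_contra! h
  have hlt := mt (le_outerRadius_iff (δ := outerRadius r D + 1) (by omega : D ≤ r ^ 2)).2 (by simp)
  have hle : (2 * (outerRadius r D + 1)) ^ 2 ≤ r ^ 2 := Nat.pow_le_pow_left (by omega) 2
  rw [mul_pow] at hle
  omega

lemma innerRadius_eq_zero_or_add_le (hsw : s + w < r) (D : ℕ) :
    innerRadius s D = 0 ∨ innerRadius s D + w ≤ outerRadius r D := by
  unfold innerRadius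
  split_ifs with h
  · right
    have hS : Nat.sqrt (s ^ 2 - D) ≤ s :=
      (Nat.sqrt_le_sqrt (Nat.sub_le _ _)).trans_eq (Nat.sqrt_eq' s)
    have hSD := Nat.sqrt_le' (s ^ 2 - D)
    generalize Nat.sqrt (s ^ 2 - D) = S at *
    have hr : (s + 1 + w) ^ 2 ≤ r ^ 2 := Nat.pow_le_pow_left (by omega) 2
    refine (le_outerRadius_iff (by nlinarith)).2 (le_trans ?_ hr)
    calc (S + 1 + w) ^ 2 + D = (S ^ 2 + D) + 2 * S * (w + 1) + (w + 1) ^ 2 := by ring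
      _ ≤ s ^ 2 + 2 * s * (w + 1) + (w + 1) ^ 2 := by gcongr; omega
      _ = (s + 1 + w) ^ 2 := by ring
  · exact Or.inl rfl

lemma margin_zero (r s : ℕ) : margin r s 0 = 0 := by
  simp [margin, outerRadius, Nat.sqrt_eq']

lemma two_mul_margin_le (s : ℕ) (hD : 4 * D ≤ 3 * r ^ 2) : 2 * margin r s D ≤ r + 1 := by
  have := le_two_mul_outerRadius_add_one hD
  have := min_le_right (innerRadius s D) (r - outerRadius r D)
  rw [margin]
  omega

lemma exists_mul_le_lt_add (hw : 0 < w) (z : ℕ) : ∃ i, i * w ≤ z ∧ z < i * w + w :=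
  ⟨z / w, Nat.div_mul_le_self z w, Nat.lt_div_mul_add hw⟩

lemma exists_mul_near {R z : ℕ} (hw : 0 < w) (hwr : w < r) (hR : r ≤ 2 * R + 1) (hz : z < r) :
    ∃ i, i * w < r ∧ ((z : ℤ) - (i * w : ℕ)).natAbs ≤ R := by
  by_cases hzR : z ≤ R
  · exact ⟨0, by omega, by omega⟩
  by_cases hzw : z < w
  · exact ⟨1, by omega, by omega⟩
  obtain ⟨i, hi, hi'⟩ := exists_mul_le_lt_add hw z
  have hi0 : 0 < i := Nat.pos_of_ne_zero fun h => by rw [h] at hi'; omega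
  have := Nat.le_mul_of_pos_left w hi0
  exact ⟨i, by omega, by omega⟩

lemma exists_localLabel_near {R y : ℕ} (hw : 0 < w) (hwr : w < r) (hR : r ≤ 2 * R + 1)
    (hy : y < 2 * r) :
    ∃ i p : ℕ, i * w < r ∧ (p = i * w ∨ p = i * w + r) ∧ p < 2 * r ∧
      ((y : ℤ) - p).natAbs ≤ R := by
  rcases lt_or_ge y r with hyr | hyr
  · obtain ⟨i, hi, hiR⟩ := exists_mul_near hw hwr hR hyr
    exact ⟨i, i * w, hi, Or.inl rfl, by omega, hiR⟩
  · obtain ⟨i, hi, hiR⟩ := exists_mul_near hw hwr hR (by omega : y - r < r)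
    exact ⟨i, i * w + r, hi, Or.inr rfl, by omega, by omega⟩

/-- The annulus `[σ, R]` has width at least `w`, so that the annuli of labels that advance in steps
of `w` leave no gap. -/
lemma exists_localLabel_in_annulus {σ R y : ℕ} (hw : 0 < w) (hσR : σ + w ≤ R) (hσr : σ + w ≤ r)
    (hy : min σ (r - R) ≤ y) (hy' : y < 2 * r + min σ (r - R)) :
    ∃ i p : ℕ, i * w < r + w ∧ (p = i * w ∨ p = i * w + r) ∧ (p < 2 * r ∨ p ≤ y) ∧
      σ ≤ ((y : ℤ) - p).natAbs ∧ ((y : ℤ) - p).natAbs ≤ R := by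
  rcases lt_or_ge y σ with hyσ | hyσ
  · by_cases hyr : y + σ ≤ r
    · exact ⟨0, r, by omega, Or.inr (by simp), by omega, by omega, by omega⟩
    · obtain ⟨i, hi, hi'⟩ := exists_mul_le_lt_add hw (y + σ - r + (w - 1))
      exact ⟨i, i * w + r, by omega, Or.inr rfl, by omega, by omega, by omega⟩
  rcases lt_or_ge y (r + σ) with hyr | hyr
  · obtain ⟨i, hi, hi'⟩ := exists_mul_le_lt_add hw (y - σ)
    exact ⟨i, i * w, by omega, Or.inl rfl, by omega, by omega, by omega⟩
  · obtain ⟨i, hi, hi'⟩ := exists_mul_le_lt_add hw (y - σ - r)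
    exact ⟨i, i * w + r, by omega, Or.inr rfl, by omega, by omega, by omega⟩

lemma exists_localLabel_reaching (hw : 0 < w) (hsw : s + w < r) (hD : 4 * D ≤ 3 * r ^ 2) {y : ℕ}
    (hy : margin r s D ≤ y) (hy' : y < 2 * r + margin r s D) :
    ∃ i p : ℕ, i * w < r + w ∧ (p = i * w ∨ p = i * w + r) ∧ (p < 2 * r ∨ p ≤ y) ∧
      s ^ 2 < ((y : ℤ) - p).natAbs ^ 2 + D ∧ ((y : ℤ) - p).natAbs ^ 2 + D ≤ r ^ 2 := by
  simp only [← innerRadius_le_iff, ← le_outerRadius_iff (by omega : D ≤ r ^ 2)]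
  rcases innerRadius_eq_zero_or_add_le hsw D with hσ | hσ
  · rw [margin, hσ, Nat.zero_min] at hy'
    obtain ⟨i, p, hi, hp, hpr, hpR⟩ := exists_localLabel_near hw (by omega)
      (le_two_mul_outerRadius_add_one hD) hy'
    exact ⟨i, p, by omega, hp, Or.inl hpr, hσ.trans_le (Nat.zero_le _), hpR⟩
  · exact exists_localLabel_in_annulus hw hσ (hσ.trans (outerRadius_le r D)) hy hy'

lemma le_ceilDiv_mul (hw : 0 < w) (r : ℕ) : r ≤ r ⌈/⌉ w * w := by
  have := (ceilDiv_le_iff_le_mul hw).1 (le_refl (r ⌈/⌉ w))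
  rwa [mul_comm] at this

lemma ceilDiv_mul_lt (hw : 0 < w) (hr : 0 < r) : r ⌈/⌉ w * w < r + w := by
  rw [Nat.ceilDiv_eq_add_pred_div]
  have := Nat.div_mul_le_self (r + w - 1) w
  omega

lemma le_ceilDiv_of_mul_lt (hw : 0 < w) {i : ℕ} (h : i * w < r + w) : i ≤ r ⌈/⌉ w := by
  refine Nat.lt_succ_iff.1 (lt_of_mul_lt_mul_right' (a := w) ?_)
  rw [Nat.succ_mul]
  have := le_ceilDiv_mul hw r
  omega

end Reception

section Local

variable {d L r s w : ℕ} {j : Fin d}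

/-- The labels of `K`, shifted by `z`. -/
def shiftLabels (K : Set ℤ) (z : ℤ) : Set ℤ := {y | ∃ k ∈ K, y = k + z}

/-- The first `t` steps of `Local*` with step length `w`. -/
def localSteps (r w : ℕ) (ε : ℤ) (K : Set ℤ) (t : ℕ) : List (Set ℤ) :=
  (List.range t).flatMap fun i =>
    [shiftLabels K (ε * ((i * w : ℕ) : ℤ)), shiftLabels K (ε * ((i * w + r : ℕ) : ℤ))]

variable {F I : Set (LatticeNode d L)} {b : LatticeNode d L} {ε k : ℤ} {K : Set ℤ}

lemma IsSparse.shift (hK : IsSparse r K) (z : ℤ) : IsSparse r (shiftLabels K z) := by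
  rintro _ ⟨k, hk, rfl⟩ _ ⟨k', hk', rfl⟩ hne
  rw [add_sub_add_right_eq_sub]
  exact hK hk hk' fun h => hne (by rw [h])

lemma localScheme_eq_localSteps (r s : ℕ) (ε : ℤ) (K : Set ℤ) :
    localScheme r s ε K = localSteps r (r - (s + 1)) ε K (r ⌈/⌉ (r - (s + 1)) + 1) := rfl

lemma localSteps_succ (r w : ℕ) (ε : ℤ) (K : Set ℤ) (t : ℕ) :
    localSteps r w ε K (t + 1) = localSteps r w ε K t ++
      [shiftLabels K (ε * ((t * w : ℕ) : ℤ)), shiftLabels K (ε * ((t * w + r : ℕ) : ℤ))] := by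
  rw [localSteps, List.range_succ, List.flatMap_append, List.flatMap_singleton]
  rfl

lemma exists_localSteps_eq_append (r w : ℕ) (ε : ℤ) (K : Set ℤ) {t t' : ℕ} (h : t ≤ t') :
    ∃ rest, localSteps r w ε K t' = localSteps r w ε K t ++ rest := by
  induction t', h using Nat.le_induction with
  | base => exact ⟨[], (List.append_nil _).symm⟩
  | succ t' _ ih =>
    obtain ⟨rest, ih⟩ := ih
    exact ⟨_, by rw [localSteps_succ, ih, List.append_assoc]⟩

lemma length_localSteps (r w : ℕ) (ε : ℤ) (K : Set ℤ) (t : ℕ) :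
    (localSteps r w ε K t).length = 2 * t := by
  simp [localSteps, List.length_flatMap, mul_comm]

lemma Known.served_localStep (hF : IsLineFamily r j F) (hb : b ∈ F) (hsr : s < r)
    (hε : ε = 1 ∨ ε = -1) (hK : IsSparse r K) (hk : k ∈ K) {z : ℕ}
    (hz : k + ε * z ∈ Set.Ico (0 : ℤ) L) (h : Known j b I (k + ε * z)) {p : ℕ}
    (hp : p = z ∨ p = z + r) :
    Served r s j b
      (lineRun r s j F [shiftLabels K (ε * (z : ℤ)), shiftLabels K (ε * ((z + r : ℕ) : ℤ))] I)
      (k + ε * p) := by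
  have hsparse := fun z' => hK.shift (ε * (z' : ℤ))
  have hfirst := h.served_lineRun (s := s) hF hb (hsparse z) ⟨k, hk, rfl⟩
  rw [← List.singleton_append, lineRun_append]
  rcases hp with rfl | rfl
  · exact hfirst.mono (subset_lineRun _ _)
  · have hreached := hfirst.known hz (y := k + ε * ((z + r : ℕ) : ℤ))
      (by rcases hε with rfl | rfl <;> omega) (by rcases hε with rfl | rfl <;> omega)
    exact hreached.served_lineRun hF hb (hsparse _) ⟨k, hk, rfl⟩

lemma known_localSteps (hF : IsLineFamily r j F) (hb : b ∈ F) (hsw : s + w < r)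
    (hε : ε = 1 ∨ ε = -1) (hK : IsSparse r K) (hk : k ∈ K) (hI : Known j b I k) {M : ℕ}
    (hM : ∀ p : ℕ, p ≤ M → k + ε * p ∈ Set.Ico (0 : ℤ) L) {i : ℕ} (hi : i * w + r ≤ M + w) :
    Known j b (lineRun r s j F (localSteps r w ε K i) I) (k + ε * ((i * w : ℕ) : ℤ)) := by
  induction i with
  | zero => simpa using hI.mono (subset_lineRun _ _)
  | succ i ih =>
    rw [Nat.succ_mul] at hi ⊢
    have hserved := (ih (by omega)).served_localStep hF hb (by omega : s < r) hε hK hk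
      (hM _ (by omega)) (Or.inr rfl)
    rw [localSteps_succ, lineRun_append]
    exact hserved.known (hM _ (by omega)) (by rcases hε with rfl | rfl <;> omega)
      (by rcases hε with rfl | rfl <;> omega)

lemma served_localScheme (hF : IsLineFamily r j F) (hb : b ∈ F) (hsr : s + 1 < r)
    (hε : ε = 1 ∨ ε = -1) (hK : IsSparse r K) (hk : k ∈ K) (hI : Known j b I k) {M : ℕ}
    (hM : ∀ p : ℕ, p ≤ M → k + ε * p ∈ Set.Ico (0 : ℤ) L) (hw : w = r - (s + 1)) {i p : ℕ}
    (hi : i * w < r + w) (hiM : i * w + r ≤ M + w) (hp : p = i * w ∨ p = i * w + r) :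
    Served r s j b (lineRun r s j F (localScheme r s ε K) I) (k + ε * p) := by
  have hknown := known_localSteps hF hb (by omega : s + w < r) hε hK hk hI hM hiM
  have hstep := hknown.served_localStep hF hb (by omega : s < r) hε hK hk (hM _ (by omega)) hp
  obtain ⟨rest, hrest⟩ := exists_localSteps_eq_append r w ε K
    (Nat.succ_le_succ (le_ceilDiv_of_mul_lt (by omega) hi))
  rw [localScheme_eq_localSteps, ← hw, hrest, lineRun_append, localSteps_succ, lineRun_append]
  exact hstep.mono (subset_lineRun _ _)

lemma mem_lineRun_localScheme (hF : IsLineFamily r j F) (hb : b ∈ F) (hsr : s + 1 < r)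
    (hε : ε = 1 ∨ ε = -1) (hK : IsSparse r K) (hk : k ∈ K) (hI : Known j b I k) {M : ℕ}
    (hM : ∀ p : ℕ, p ≤ M → k + ε * p ∈ Set.Ico (0 : ℤ) L) (hrM : 2 * r ≤ M + 1)
    {v : LatticeNode d L} (hD : 4 * sqDistLine j b v ≤ 3 * r ^ 2) {y : ℕ}
    (hv : (v j : ℤ) = k + ε * y) (hyM : y ≤ M) (hy : margin r s (sqDistLine j b v) ≤ y)
    (hy' : y < 2 * r + margin r s (sqDistLine j b v)) :
    v ∈ lineRun r s j F (localScheme r s ε K) I := by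
  obtain ⟨i, p, hi, hp, hpM, hin, hout⟩ :=
    exists_localLabel_reaching (w := r - (s + 1)) (by omega) (by omega) hD hy hy'
  have hserved := served_localScheme hF hb hsr hε hK hk hI hM rfl hi (by omega) hp
  have hdist : (k + ε * p - (v j : ℤ)).natAbs = ((y : ℤ) - p).natAbs := by
    rw [hv]
    rcases hε with rfl | rfl <;> omega
  rw [← hdist] at hin hout
  exact hserved.mem (hM p (by omega)) hin hout

end Local

section AlgorithmA

variable {d L r s : ℕ} {j : Fin d} {F I : Set (LatticeNode d L)} {b : LatticeNode d L}

/-- The labels `a, a + 4r, a + 8r, …`, from which `Local*` is started in parallel. -/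
def localStarts (r a : ℕ) : Set ℤ := {k | ∃ m : ℕ, k = ((a + 4 * r * m : ℕ) : ℤ)}

lemma isSparse_localStarts (hr : 0 < r) (a : ℕ) : IsSparse r (localStarts r a) := by
  rintro _ ⟨m, rfl⟩ _ ⟨m', rfl⟩ hne
  have hmm' : 1 ≤ ((m : ℤ) - m').natAbs := by
    by_contra! h
    exact hne (by rw [show m = m' by omega])
  have hdiff : ((a + 4 * r * m : ℕ) : ℤ) - ((a + 4 * r * m' : ℕ) : ℤ) =
      ((4 * r : ℕ) : ℤ) * ((m : ℤ) - m') := by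
    push_cast
    ring
  rw [hdiff, Int.natAbs_mul, Int.natAbs_natCast]
  nlinarith

lemma served_chain (hF : IsLineFamily r j F) (hb : b ∈ F) (hsr : s < r) {a : ℕ → ℤ} {N : ℕ}
    (ha : ∀ m < N, a m ∈ Set.Ico (0 : ℤ) L) (hstep : ∀ m, (a m - a (m + 1)).natAbs = r)
    (hI : Known j b I (a 0)) {m : ℕ} (hm : m < N) :
    Served r s j b (lineRun r s j F ((List.range N).map fun m => {a m}) I) (a m) := by
  induction N generalizing m with
  | zero => omega
  | succ N ih =>
    have ih := fun {m} => ih (m := m) fun m' hm' => ha m' (by omega)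
    rw [List.range_succ, List.map_append, lineRun_append]
    rcases Nat.lt_succ_iff_lt_or_eq.1 hm with h | rfl
    · exact (ih h).mono (subset_lineRun _ _)
    · refine Known.served_lineRun hF hb (isSparse_singleton r (a m)) rfl ?_
      rcases m with - | m
      · exact hI.mono (subset_lineRun _ _)
      · exact (ih m.lt_succ_self).known (ha m (by omega)) (by rwa [hstep]) (hstep m).le

lemma known_chain (hF : IsLineFamily r j F) (hb : b ∈ F) (hsr : s < r) {a : ℕ → ℤ} {N : ℕ}
    (ha : ∀ m < N, a m ∈ Set.Ico (0 : ℤ) L) (hstep : ∀ m, (a m - a (m + 1)).natAbs = r)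
    (hI : Known j b I (a 0)) {m : ℕ} (hm : m ≤ N) :
    Known j b (lineRun r s j F ((List.range N).map fun m => {a m}) I) (a m) := by
  rcases m with - | m
  · exact hI.mono (subset_lineRun _ _)
  · exact (served_chain hF hb hsr ha hstep hI hm).known (ha m hm) (by rwa [hstep]) (hstep m).le

lemma known_sparsePart (hF : IsLineFamily r j F) (hb : b ∈ F) (hsr : s < r) {c : ℕ} (hc : c < L)
    (hI : Known j b I c) {a : ℕ} (haL : a < L) (ha : a ≡ c [MOD r]) :
    Known j b (lineRun r s j F (sparsePart L r c) I) a := by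
  have hr : 0 < r := by omega
  have hup : ∀ m < (L - 1 - c) / r + 1, ((c + m * r : ℕ) : ℤ) ∈ Set.Ico (0 : ℤ) L := by
    intro m hm
    have := (Nat.le_div_iff_mul_le hr).1 (Nat.lt_succ_iff.1 hm)
    constructor <;> omega
  have hup_step (m : ℕ) :
      (((c + m * r : ℕ) : ℤ) - ((c + (m + 1) * r : ℕ) : ℤ)).natAbs = r := by
    rw [Nat.succ_mul]
    omega
  have hI₀ : Known j b I ((c + 0 * r : ℕ) : ℤ) := by rwa [zero_mul]
  rw [sparsePart, lineRun_append]
  rcases le_total c a with hca | hac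
  · obtain ⟨m, hm⟩ := (Nat.modEq_iff_dvd' hca).1 ha.symm
    obtain rfl : a = c + m * r := by rw [mul_comm]; omega
    have hmN : m ≤ (L - 1 - c) / r := (Nat.le_div_iff_mul_le hr).2 (by omega)
    exact (known_chain hF hb hsr hup hup_step hI₀ (by omega)).mono (subset_lineRun _ _)
  · obtain ⟨m, hm⟩ := (Nat.modEq_iff_dvd' hac).1 ha
    rcases m with - | m
    · obtain rfl : a = c := by omega
      exact (hI.mono (subset_lineRun _ _)).mono (subset_lineRun _ _)
    have haZ : (a : ℤ) = (c : ℤ) - (((m + 1) * r : ℕ) : ℤ) := by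
      rw [mul_comm]
      omega
    have hmN : m + 1 ≤ c / r := (Nat.le_div_iff_mul_le hr).2 (by rw [mul_comm]; omega)
    have hserved := served_chain hF hb hsr hup hup_step hI₀ (Nat.succ_pos _)
    rw [haZ]
    refine known_chain hF hb hsr (a := fun m => (c : ℤ) - (((m + 1) * r : ℕ) : ℤ))
      (fun m hm => ?_) (fun m => ?_) (hserved.known (hup 0 (Nat.succ_pos _)) ?_ ?_) (by omega)
    · have := (Nat.le_div_iff_mul_le hr).1 (Nat.succ_le_of_lt hm)
      rw [Nat.succ_mul] at this ⊢
      constructor <;> omega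
    · rw [Nat.succ_mul (m + 1)]
      omega
    all_goals omega

lemma mem_lineRun_localStarts (hF : IsLineFamily r j F) (hb : b ∈ F) (hsr : s + 1 < r) {q : ℕ}
    (hI : ∀ m : ℕ, Known j b I ((q + 2 * r * m : ℕ) : ℤ)) {v : LatticeNode d L}
    (hD : 4 * sqDistLine j b v ≤ 3 * r ^ 2)
    (hlow : q + margin r s (sqDistLine j b v) ≤ v j)
    (hhigh : v j + 2 * r ≤ L + margin r s (sqDistLine j b v)) :
    v ∈ lineRun r s j F (localScheme r s 1 (localStarts r q) ++
      localScheme r s 1 (localStarts r (q + 2 * r))) I := by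
  set μ := margin r s (sqDistLine j b v)
  have hmod := Nat.div_add_mod (v j - (q + μ)) (2 * r)
  have hlt := Nat.mod_lt (v j - (q + μ)) (show 0 < 2 * r by omega)
  set m := (v j - (q + μ)) / (2 * r)
  have covered : ∀ {K : Set ℤ} {J : Set (LatticeNode d L)}, IsSparse r K →
      ((q + 2 * r * m : ℕ) : ℤ) ∈ K → I ⊆ J → v ∈ lineRun r s j F (localScheme r s 1 K) J :=
    fun hK hk hJ => mem_lineRun_localScheme hF hb hsr (Or.inl rfl) hK hk ((hI m).mono hJ)
      (M := L - 1 - (q + 2 * r * m)) (y := v j - (q + 2 * r * m))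
      (fun p hp => by constructor <;> omega) (by omega) hD (by omega) (by omega) (by omega)
      (by omega)
  rw [lineRun_append]
  rcases Nat.even_or_odd' m with ⟨m', hm' | hm'⟩
  · exact subset_lineRun _ _
      (covered (isSparse_localStarts (by omega) q) ⟨m', by rw [hm']; ring_nf⟩ subset_rfl)
  · exact covered (isSparse_localStarts (by omega) (q + 2 * r)) ⟨m', by rw [hm']; ring_nf⟩
      (subset_lineRun _ _)

lemma known_localScheme_two_mul_sub_one (hF : IsLineFamily r j F) (hb : b ∈ F)
    (hsr : s + 1 < r) (hrL : 2 * r ≤ L) {K : Set ℤ} (hK : IsSparse r K) {q : ℕ} (hq : q < r)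
    (hk : (q : ℤ) ∈ K) (hI : Known j b I q) :
    Known j b (lineRun r s j F (localScheme r s 1 K) I) (2 * (r : ℤ) - 1) := by
  obtain ⟨w, hw⟩ : ∃ w, w = r - (s + 1) := ⟨_, rfl⟩
  obtain ⟨i, hi, hi'⟩ :=
    exists_mul_le_lt_add (by omega : 0 < w) (r - 1 - q + (w - 1))
  have hserved := served_localScheme hF hb hsr (Or.inl rfl) hK hk hI (M := L - 1 - q)
    (fun p hp => by constructor <;> omega) hw (i := i) (by omega) (by omega) (Or.inl rfl)
  exact hserved.known (by constructor <;> omega) (by omega) (by omega)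

lemma mem_lineRun_leftPart (hF : IsLineFamily r j F) (hb : b ∈ F) (hsr : s + 1 < r)
    (hrL : 2 * r ≤ L) {q : ℕ} (hq : q < r)
    (hI : ∀ m : ℕ, Known j b I ((q + 2 * r * m : ℕ) : ℤ)) {v : LatticeNode d L}
    (hD : 4 * sqDistLine j b v ≤ 3 * r ^ 2)
    (hhigh : v j + 2 * r ≤ L + margin r s (sqDistLine j b v)) :
    v ∈ lineRun r s j F ((localScheme r s 1 (localStarts r q) ++
      localScheme r s 1 (localStarts r (q + 2 * r))) ++
      localScheme r s (-1) {2 * (r : ℤ) - 1}) I := by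
  rw [lineRun_append]
  have hmargin := two_mul_margin_le s hD
  rcases lt_or_ge (v j + margin r s (sqDistLine j b v)) (2 * r) with hleft | hmid
  · have hend : Known j b (lineRun r s j F (localScheme r s 1 (localStarts r q) ++
        localScheme r s 1 (localStarts r (q + 2 * r))) I) (2 * (r : ℤ) - 1) := by
      rw [lineRun_append]
      exact (known_localScheme_two_mul_sub_one hF hb hsr hrL (isSparse_localStarts (by omega) q)
        hq ⟨0, rfl⟩ (hI 0)).mono (subset_lineRun _ _)
    exact mem_lineRun_localScheme hF hb hsr (Or.inr rfl) (isSparse_singleton _ _) rfl hend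
      (M := 2 * r - 1) (y := 2 * r - 1 - v j) (fun p hp => by constructor <;> omega) (by omega)
      hD (by omega) (by omega) (by omega) (by omega)
  · exact subset_lineRun _ _ (mem_lineRun_localStarts hF hb hsr hI hD (by omega) hhigh)

lemma algA_eq_append (L r s c : ℕ) :
    algA L r s c = sparsePart L r c ++ (((localScheme r s 1 (localStarts r (c % r)) ++
      localScheme r s 1 (localStarts r (c % r + 2 * r))) ++
      localScheme r s (-1) {2 * (r : ℤ) - 1}) ++
      localScheme r s 1 {(L : ℤ) - 2 * (r : ℤ)}) := by
  simp only [algA, localStarts, List.append_assoc]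

lemma mem_lineRun_algA (hF : IsLineFamily r j F) (hb : b ∈ F) (hsr : s + 1 < r)
    (hrL : 2 * r ≤ L) {c : ℕ} (hc : c < L) (hI : Known j b I c) {v : LatticeNode d L}
    (hD : 4 * sqDistLine j b v ≤ 3 * r ^ 2) : v ∈ lineRun r s j F (algA L r s c) I := by
  have hsparse : ∀ m : ℕ, Known j b (lineRun r s j F (sparsePart L r c) I)
      ((c % r + 2 * r * m : ℕ) : ℤ) := by
    rintro m u hu huj
    refine known_sparsePart hF hb (by omega) hc hI (by omega) ?_ u hu huj
    rw [mul_comm 2, mul_assoc, Nat.ModEq, Nat.add_mul_mod_self_left, Nat.mod_mod]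
  have hleft := fun {v} => mem_lineRun_leftPart hF hb hsr hrL (v := v)
    (Nat.mod_lt c (by omega)) hsparse
  rw [algA_eq_append, lineRun_append, lineRun_append]
  rcases le_or_gt (v j + 2 * r) (L + margin r s (sqDistLine j b v)) with hv | hv
  · exact subset_lineRun _ _ (hleft hD hv)
  · refine mem_lineRun_localScheme hF hb hsr (Or.inl rfl) (isSparse_singleton _ _) rfl ?_
      (M := 2 * r - 1) (y := v j + 2 * r - L) (fun p hp => by constructor <;> omega) (by omega)
      hD (by omega) (by omega) (by omega) (by omega)
    intro u hu huj
    have hu0 := sqDistLine_eq_zero hu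
    exact hleft (by omega) (by rw [hu0, margin_zero]; omega)

end AlgorithmA

section Stages

variable {d L r s : ℕ}

/-- The distance of consecutive lines of stage `j` along a transversal axis. -/
def lineGap (r j : ℕ) : ℕ := max 1 (2 * halfGap r j)

lemma four_mul_halfGap_sq_le (r j : ℕ) : 4 * (j * halfGap r j ^ 2) ≤ 3 * r ^ 2 := by
  have hsqrt := Nat.mul_le_mul_left (4 * j) (Nat.sqrt_le' (3 * r ^ 2 / (4 * j)))
  rw [← mul_assoc]
  exact hsqrt.trans (Nat.mul_div_le _ _)

lemma three_mul_sq_lt_halfGap (r : ℕ) {j : ℕ} (hj : 1 ≤ j) :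
    3 * r ^ 2 < (halfGap r j + 1) ^ 2 * (4 * j) := by
  rw [← Nat.div_lt_iff_lt_mul (by omega)]
  exact Nat.lt_succ_sqrt' _

lemma halfGap_lt_lineGap (r j : ℕ) : halfGap r j < lineGap r j := by
  rw [lineGap]
  omega

lemma two_mul_le_lineGap (r : ℕ) {j : ℕ} (hj : 1 ≤ j) : 2 * r ≤ (3 * j - 1) * lineGap r j := by
  have hsq := three_mul_sq_lt_halfGap r hj
  have hgap := halfGap_lt_lineGap r j
  obtain ⟨i, rfl⟩ := Nat.exists_eq_add_of_le' hj
  rw [show 3 * (i + 1) - 1 = 3 * i + 2 by omega]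
  rcases Nat.eq_zero_or_pos i with rfl | hi
  · rw [lineGap]
    generalize halfGap r (0 + 1) = h at *
    by_contra! hlt
    have : 2 * h + 1 ≤ r ∧ 1 < r := by omega
    nlinarith
  · refine (Nat.pow_le_pow_iff_left two_ne_zero).1 ?_
    have hcoeff : 16 * (i + 1) ≤ 3 * (3 * i + 2) ^ 2 := by nlinarith
    have hle : (halfGap r (i + 1) + 1) ^ 2 ≤ lineGap r (i + 1) ^ 2 :=
      Nat.pow_le_pow_left hgap 2
    have := Nat.mul_le_mul hcoeff hle
    nlinarith

lemma mem_lineCoords {j e z : ℕ} :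
    z ∈ lineCoords L r j e ↔ ∃ m : ℕ, m % (3 * j) = e ∧
      halfGap r j + lineGap r j * m < L - 1 + lineGap r j ∧
      z = min (halfGap r j + lineGap r j * m) (L - 1) :=
  Iff.rfl

lemma two_mul_lt_natAbs_sub_of_mem_lineCoords {j e z z' : ℕ} (hj : 1 ≤ j)
    (hz : z ∈ lineCoords L r j e) (hz' : z' ∈ lineCoords L r j e) (hne : z ≠ z') :
    2 * r < ((z : ℤ) - z').natAbs := by
  wlog hlt : z < z' generalizing z z'
  · rw [← Int.natAbs_neg, neg_sub]
    exact this hz' hz hne.symm (by omega)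
  obtain ⟨m, hm, -, rfl⟩ := mem_lineCoords.1 hz
  obtain ⟨m', hm', hmL', rfl⟩ := mem_lineCoords.1 hz'
  have hgap := two_mul_le_lineGap r hj
  generalize lineGap r j = g at *
  have hmm' : m < m' := by
    by_contra! hle
    have := Nat.mul_le_mul_left g hle
    omega
  have hclass : m + 3 * j ≤ m' := Nat.ModEq.add_le_of_lt (hm.trans hm'.symm) hmm'
  have hfar : g * m + (3 * j - 1) * g + g ≤ g * m' := by
    calc g * m + (3 * j - 1) * g + g = g * (m + (3 * j - 1 + 1)) := by ring
      _ ≤ g * m' := Nat.mul_le_mul_left g (by omega)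
  have hg : 0 < g := Nat.pos_of_ne_zero fun h => by simp [h] at hlt
  omega

lemma exists_mem_lineCoords (r : ℕ) {j z : ℕ} (hj : 1 ≤ j) (hz : z < L) :
    ∃ e < 3 * j, ∃ z' < L, z' ∈ lineCoords L r j e ∧
      ((z' : ℤ) - z).natAbs ≤ halfGap r j := by
  have hdiv := Nat.div_add_mod z (lineGap r j)
  have hmod := Nat.mod_lt z ((Nat.zero_le _).trans_lt (halfGap_lt_lineGap r j))
  have hgap : lineGap r j = max 1 (2 * halfGap r j) := rfl
  refine ⟨_, Nat.mod_lt (z / lineGap r j) (by omega), _, ?_,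
    mem_lineCoords.2 ⟨z / lineGap r j, rfl, ?_, rfl⟩, ?_⟩
  all_goals omega

lemma exists_forall_div_pow_mod_eq {j B : ℕ} (f : Fin j → ℕ) (hf : ∀ l, f l < B) :
    ∃ e < B ^ j, ∀ l : Fin j, e / B ^ (l : ℕ) % B = f l := by
  refine ⟨_, (finFunctionFinEquiv fun l => (⟨f l, hf l⟩ : Fin B)).isLt, fun l => ?_⟩
  have := congrArg Fin.val (congrFun
    (finFunctionFinEquiv.symm_apply_apply fun l => (⟨f l, hf l⟩ : Fin B)) l)
  simpa [finFunctionFinEquiv] using this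

/-- The nodes on the lines on which Algorithm `A` is executed in phase `e` of stage `j`. -/
def phaseLines (r : ℕ) (src : LatticeNode d L) (j : Fin d) (e : ℕ) : Set (LatticeNode d L) :=
  {v | (∀ l : Fin d, l < j →
    ((v l : ℕ) ∈ lineCoords L r j (e / (3 * (j : ℕ)) ^ (l : ℕ) % (3 * (j : ℕ))))) ∧
    ∀ l : Fin d, j < l → v l = src l}

/-- The rounds of stage `j` of Algorithm `A^d`. -/
def stage (r s : ℕ) (src : LatticeNode d L) (j : Fin d) : List (Set (LatticeNode d L)) :=
  (List.range ((3 * (j : ℕ)) ^ (j : ℕ))).flatMap fun e =>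
    (algA L r s (src j)).map (onLines j (phaseLines r src j e))

lemma algAd_eq_flatMap_stage (src : LatticeNode d L) :
    algAd d L r s src = (List.finRange d).flatMap (stage r s src) := rfl

lemma isLineFamily_phaseLines (r : ℕ) (src : LatticeNode d L) (j : Fin d) (e : ℕ) :
    IsLineFamily r j (phaseLines r src j e) where
  axisLine_subset b hb u hu :=
    ⟨fun l hl => by rw [hu l hl.ne]; exact hb.1 l hl,
      fun l hl => by rw [hu l hl.ne']; exact hb.2 l hl⟩
  mem_axisLine_or_far u hu u' hu' := by
    by_cases h : ∀ l < j, u l = u' l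
    · refine Or.inl fun l hl => ?_
      rcases lt_or_gt_of_ne hl with hlj | hjl
      · exact h l hlj
      · rw [hu.2 l hjl, hu'.2 l hjl]
    · push Not at h
      obtain ⟨l, hl, hne⟩ := h
      have hj : 1 ≤ (j : ℕ) := Nat.one_le_of_lt hl
      right
      exact_mod_cast lt_dist_pos_of_lt_natAbs_sub (two_mul_lt_natAbs_sub_of_mem_lineCoords hj
        (hu.1 l hl) (hu'.1 l hl) fun h => hne (Fin.ext h))

lemma sqDistLine_le_mul_sq {j : Fin d} {b v : LatticeNode d L} {h : ℕ}
    (hlt : ∀ l < j, ((b l : ℤ) - (v l : ℤ)).natAbs ≤ h) (hgt : ∀ l, j < l → b l = v l) :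
    sqDistLine j b v ≤ j * h ^ 2 := by
  have hsub : Finset.Iio j ⊆ Finset.univ.erase j := fun l hl =>
    Finset.mem_erase.2 ⟨(Finset.mem_Iio.1 hl).ne, Finset.mem_univ l⟩
  rw [sqDistLine, ← Finset.sum_subset hsub fun l hl hlj => ?_]
  · refine (Finset.sum_le_card_nsmul _ _ (h ^ 2) fun l hl => ?_).trans_eq ?_
    · exact Nat.pow_le_pow_left (hlt l (Finset.mem_Iio.1 hl)) 2
    · rw [Fin.card_Iio, smul_eq_mul]
  · have hjl : j < l := lt_of_le_of_ne (not_lt.1 (mt Finset.mem_Iio.2 hlj))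
      (Finset.ne_of_mem_erase hl).symm
    simp [hgt l hjl]

lemma exists_phaseLines_near (r : ℕ) (src : LatticeNode d L) (j : Fin d) {v : LatticeNode d L}
    (hv : ∀ l, j < l → v l = src l) :
    ∃ e < (3 * (j : ℕ)) ^ (j : ℕ), ∃ b ∈ phaseLines r src j e,
      4 * sqDistLine j b v ≤ 3 * r ^ 2 := by
  have hnear (l : Fin j) : ∃ f < 3 * (j : ℕ), ∃ z < L, z ∈ lineCoords L r j f ∧
      ((z : ℤ) - (v ⟨l, by omega⟩ : ℕ)).natAbs ≤ halfGap r j :=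
    exists_mem_lineCoords r (by have := l.isLt; omega) (v ⟨l, by omega⟩).isLt
  choose f hf z hzL hz hzv using hnear
  obtain ⟨e, he, hdigit⟩ := exists_forall_div_pow_mod_eq f hf
  let b : LatticeNode d L := fun l => if h : (l : ℕ) < j then ⟨z ⟨l, h⟩, hzL _⟩ else v l
  have hb_lt (l : Fin d) (h : l < j) : (b l : ℕ) = z ⟨l, h⟩ := by
    simp only [b, dif_pos (Fin.lt_def.1 h)]
  have hb_gt (l : Fin d) (h : j < l) : b l = v l := dif_neg (Fin.lt_def.1 h).not_gt
  refine ⟨e, he, b, ⟨fun l hl => ?_, fun l hl => (hb_gt l hl).trans (hv l hl)⟩, ?_⟩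
  · rw [hb_lt l hl, hdigit ⟨l, hl⟩]
    exact hz ⟨l, hl⟩
  · have hdist : sqDistLine j b v ≤ j * halfGap r j ^ 2 := sqDistLine_le_mul_sq
      (fun l hl => by rw [hb_lt l hl]; exact hzv ⟨l, hl⟩) hb_gt
    have := four_mul_halfGap_sq_le r j
    omega

lemma mem_informedFrom_stage (hsr : s + 1 < r) (hrL : 2 * r ≤ L) {src : LatticeNode d L}
    {j : Fin d} {I : Set (LatticeNode d L)}
    (hI : ∀ v : LatticeNode d L, (∀ l, j ≤ l → v l = src l) → v ∈ I) {v : LatticeNode d L}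
    (hv : ∀ l, j < l → v l = src l) : v ∈ informedFrom r s (stage r s src j) I := by
  obtain ⟨e, he, b, hb, hbv⟩ := exists_phaseLines_near r src j hv
  have hsource : Known j b I (src j : ℕ) := fun u hu huj => hI u fun l hl => by
    rcases hl.lt_or_eq with hlt | rfl
    · rw [hu l hlt.ne', hb.2 l hlt]
    · exact Fin.ext (by exact_mod_cast huj)
  obtain ⟨before, after, hsplit⟩ := List.append_of_mem (List.mem_range.2 he)
  rw [stage, hsplit, List.flatMap_append, List.flatMap_cons, informedFrom_append,
    informedFrom_append]
  exact subset_informedFrom _ _ (mem_lineRun_algA (isLineFamily_phaseLines r src j e) hb hsr hrL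
    (src j).isLt (hsource.mono (subset_informedFrom _ _)) hbv)

lemma mem_informedFrom_take_stages (hsr : s + 1 < r) (hrL : 2 * r ≤ L)
    {src : LatticeNode d L} {n : ℕ} (hn : n ≤ d) {v : LatticeNode d L}
    (hv : ∀ l : Fin d, n ≤ l → v l = src l) :
    v ∈ informedFrom r s (((List.finRange d).take n).flatMap (stage r s src)) {src} := by
  induction n generalizing v with
  | zero => exact funext fun l => hv l (Nat.zero_le _)
  | succ n ih =>
    have hlt : n < (List.finRange d).length := by rwa [List.length_finRange]
    rw [← List.take_concat_get' _ _ hlt, List.flatMap_append, List.flatMap_singleton,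
      informedFrom_append, List.getElem_finRange]
    exact mem_informedFrom_stage hsr hrL (fun u hu => ih (by omega) fun l hl => hu l hl)
      fun l hl => hv l hl

lemma mem_informed_algAd (hsr : s + 1 < r) (hrL : 2 * r ≤ L) (src v : LatticeNode d L) :
    v ∈ informed r s (algAd d L r s src) src (algAd d L r s src).length := by
  have hmem := mem_informedFrom_take_stages hsr hrL (src := src) le_rfl (v := v)
    fun l hl => absurd l.isLt hl.not_gt
  rwa [List.take_of_length_le (List.length_finRange).le, ← algAd_eq_flatMap_stage,
    ← informed_length] at hmem

end Stages

section UpperBound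

variable {d L r s : ℕ}

lemma length_algA (L r s c : ℕ) : (algA L r s c).length =
    (L - 1 - c) / r + 1 + c / r + 8 * (r ⌈/⌉ (r - (s + 1)) + 1) := by
  simp only [algA, sparsePart, List.length_append, localScheme_eq_localSteps, length_localSteps,
    List.length_map, List.length_range]
  ring

lemma length_algA_le (hsr : s + 1 < r) {c : ℕ} (hc : c < L) :
    ((algA L r s c).length : ℝ) ≤ 25 * ((L : ℝ) / r + r / ((r : ℝ) - (s + 1))) := by
  obtain ⟨w, rfl⟩ := Nat.exists_eq_add_of_le hsr.le
  have hw : (0 : ℝ) < w := by exact_mod_cast (by omega : 0 < w)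
  have hwr : ((s + 1 + w : ℕ) : ℝ) - (s + 1) = w := by push_cast; ring
  rw [length_algA, hwr, Nat.add_sub_cancel_left]
  set r := s + 1 + w
  have hr0 : (0 : ℝ) < r := by exact_mod_cast (by omega : 0 < r)
  have hsparse : (((L - 1 - c) / r : ℕ) : ℝ) + ((c / r : ℕ) : ℝ) ≤ (L : ℝ) / r := by
    have hright := Nat.div_mul_le_self (L - 1 - c) r
    have hleft := Nat.div_mul_le_self c r
    rw [le_div_iff₀ hr0, add_mul]
    exact_mod_cast (by omega : (L - 1 - c) / r * r + c / r * r ≤ L)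
  have hlocal : ((r ⌈/⌉ w : ℕ) : ℝ) ≤ (r : ℝ) / w + 1 := by
    rw [div_add_one hw.ne', le_div_iff₀ hw]
    exact_mod_cast (ceilDiv_mul_lt (by omega) (by omega)).le
  have hone : (1 : ℝ) ≤ (r : ℝ) / w := by
    rw [one_le_div hw]
    exact_mod_cast (by omega : w ≤ r)
  have : (0 : ℝ) ≤ (L : ℝ) / r := by positivity
  push_cast
  linarith

lemma length_stage (src : LatticeNode d L) (j : Fin d) : (stage r s src j).length =
    (3 * (j : ℕ)) ^ (j : ℕ) * (algA L r s (src j)).length := by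
  simp [stage, List.length_flatMap]

lemma length_stage_le (hsr : s + 1 < r) (src : LatticeNode d L) (j : Fin d) :
    ((stage r s src j).length : ℝ) ≤
      (3 * d) ^ d * (25 * ((L : ℝ) / r + r / ((r : ℝ) - (s + 1)))) := by
  have hj := j.isLt
  have hphases : (3 * (j : ℕ)) ^ (j : ℕ) ≤ (3 * d) ^ d :=
    (Nat.pow_le_pow_left (by omega) _).trans (Nat.pow_le_pow_right (by omega) hj.le)
  rw [length_stage, Nat.cast_mul]
  gcongr
  · exact_mod_cast hphases
  · exact length_algA_le hsr (src j).isLt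

lemma length_algAd_le (hsr : s + 1 < r) (src : LatticeNode d L) :
    ((algAd d L r s src).length : ℝ) ≤
      25 * (3 * d) ^ d * (d * ((L : ℝ) / r + r / ((r : ℝ) - (s + 1)))) := by
  rw [algAd_eq_flatMap_stage, List.length_flatMap, ← Fin.sum_univ_def, Nat.cast_sum]
  calc ∑ j, ((stage r s src j).length : ℝ)
      ≤ ∑ _j : Fin d, (3 * d) ^ d * (25 * ((L : ℝ) / r + r / ((r : ℝ) - (s + 1)))) :=
        Finset.sum_le_sum fun j _ => length_stage_le hsr src j
    _ = 25 * (3 * d) ^ d * (d * ((L : ℝ) / r + r / ((r : ℝ) - (s + 1)))) := by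
        rw [Finset.sum_const, Finset.card_univ, Fintype.card_fin, nsmul_eq_mul]
        ring

end UpperBound

section LowerBound

variable {d L r s w t : ℕ}

lemma le_four_mul_of_forall_mem_informed [NeZero d] (hL : 2 ≤ L)
    {sched : List (Set (LatticeNode d L))} {src : LatticeNode d L}
    (h : ∀ v, v ∈ informed r s sched src t) : L ≤ 4 * (t * r) := by
  have hfirst := natAbs_sub_le_of_mem_informed (h fun _ => ⟨0, by omega⟩) 0
  have hlast := natAbs_sub_le_of_mem_informed (h fun _ => ⟨L - 1, by omega⟩) 0
  simp only at hfirst hlast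
  omega

lemma exists_algAd_eq_append [NeZero d] (src : LatticeNode d L)
    (ht : t ≤ r ⌈/⌉ (r - (s + 1)) + 1) :
    ∃ rest, algAd d L r s src =
      (sparsePart L r (src 0) ++
        localSteps r (r - (s + 1)) 1 (localStarts r ((src 0 : ℕ) % r)) t).map
          (onLines 0 (phaseLines r src 0 0)) ++ rest := by
  obtain ⟨d, rfl⟩ := Nat.exists_eq_succ_of_ne_zero (NeZero.ne d)
  obtain ⟨rest, hrest⟩ := exists_localSteps_eq_append r (r - (s + 1)) 1
    (localStarts r ((src 0 : ℕ) % r)) ht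
  have hstage : stage r s src 0 = (algA L r s (src 0)).map (onLines 0 (phaseLines r src 0 0)) := by
    simp [stage]
  rw [algAd_eq_flatMap_stage, List.finRange_succ, List.flatMap_cons, hstage, algA_eq_append,
    localScheme_eq_localSteps r s 1 (localStarts r ((src 0 : ℕ) % r)), hrest]
  simp only [List.map_append, List.append_assoc]
  exact ⟨_, rfl⟩

lemma exists_eq_add_mul_of_mem_sparsePart {c : ℕ} {S : Set ℤ} (hS : S ∈ sparsePart L r c) {a : ℤ}
    (ha : a ∈ S) : ∃ m : ℕ, a = ((c % r + r * m : ℕ) : ℤ) := by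
  have hc := Nat.mod_add_div c r
  rcases List.mem_append.1 hS with hS | hS
  · obtain ⟨m, -, rfl⟩ := List.mem_map.1 hS
    obtain rfl : a = _ := ha
    exact ⟨c / r + m, by rw [mul_add, mul_comm r m]; omega⟩
  · obtain ⟨m, hm, rfl⟩ := List.mem_map.1 hS
    obtain rfl : a = _ := ha
    have hle := Nat.mul_le_mul_right r (Nat.succ_le_of_lt (List.mem_range.1 hm))
    refine ⟨c / r - (m + 1), ?_⟩
    rw [Nat.mul_sub, mul_comm r (m + 1)]
    rw [mul_comm (c / r) r, Nat.succ_eq_add_one] at hle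
    omega

lemma notMem_annulus_of_mem_sparsePart (hsr : s < r) (hrs : r ≤ 2 * s) {c : ℕ} {S : Set ℤ}
    (hS : S ∈ sparsePart L r c) {a : ℤ} (ha : a ∈ S) :
    (a - ((c % r + s : ℕ) : ℤ)).natAbs ∉ Set.Ioc s r := by
  obtain ⟨m, rfl⟩ := exists_eq_add_mul_of_mem_sparsePart hS ha
  rintro ⟨hs, hr⟩
  rcases m with - | - | m
  · omega
  · omega
  · rw [mul_add, mul_add] at hr
    omega

lemma notMem_annulus_of_mem_localSteps (hsr : s < r) (hrw : r ≤ s + 1 + w) (hws : (t + 1) * w < s)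
    {q : ℕ} {S : Set ℤ} (hS : S ∈ localSteps r w 1 (localStarts r q) t) {a : ℤ} (ha : a ∈ S) :
    (a - ((q + s : ℕ) : ℤ)).natAbs ∉ Set.Ioc s r := by
  obtain ⟨i, hi, hS⟩ := List.mem_flatMap.1 hS
  have hiw := Nat.mul_le_mul_right w (Nat.succ_le_of_lt (List.mem_range.1 hi))
  rw [Nat.succ_mul] at hiw hws
  simp only [List.mem_cons, List.not_mem_nil, or_false] at hS
  rintro ⟨hs, hr⟩
  rcases hS with rfl | rfl
  all_goals
    obtain ⟨_, ⟨m, rfl⟩, rfl⟩ := ha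
    rcases m with - | m
    · omega
    · rw [mul_add] at hs hr
      omega

lemma le_add_one_mul_of_forall_mem_informed [NeZero d] (hsr : s + 1 < r) (hrL : 2 * r ≤ L)
    {src : LatticeNode d L} (h : ∀ v, v ∈ informed r s (algAd d L r s src) src t) :
    s ≤ (t + 1) * (r - (s + 1)) := by
  by_contra! hlt
  have hlt' := hlt
  rw [add_one_mul] at hlt'
  have ht := le_ceilDiv_of_mul_lt (r := r) (by omega : 0 < r - (s + 1)) (i := t) (by omega)
  obtain ⟨rest, hrest⟩ := exists_algAd_eq_append (r := r) (s := s) src (t := t) (by omega)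
  have hq : (src 0 : ℕ) % r < r := Nat.mod_lt _ (by omega)
  obtain ⟨v, hv, hv0⟩ := exists_mem_axisLine (0 : Fin d) src
    (a := (((src 0 : ℕ) % r + s : ℕ) : ℤ)) ⟨by omega, by omega⟩
  have hne : v ≠ src := by
    rintro rfl
    have hmod : ((v 0 : ℕ) % r + s) ≡ (v 0 : ℕ) % r + 0 [MOD r] := by
      rw [add_zero, Nat.ModEq, Nat.mod_mod]
      exact congrArg (· % r) (by exact_mod_cast hv0.symm)
    have := Nat.ModEq.eq_of_lt_of_lt hmod.add_left_cancel' (by omega) (by omega)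
    omega
  refine notMem_informed_append ?_ hne ?_ (hrest ▸ h v)
  · rw [List.length_map, List.length_append, length_localSteps]
    omega
  · intro X hX u hu huv
    obtain ⟨S, hS, rfl⟩ := List.mem_map.1 hX
    have hline : u ∈ axisLine 0 v := fun l hl =>
      (hu.2.2 l (Fin.pos_iff_ne_zero.2 hl)).trans (hv l hl).symm
    rw [swampGraph_adj_iff_of_mem_axisLine hline, hv0] at huv
    rcases List.mem_append.1 hS with hS | hS
    · exact notMem_annulus_of_mem_sparsePart (by omega) (by omega) hS hu.1 huv
    · exact notMem_annulus_of_mem_localSteps (by omega) (by omega) hlt hS hu.1 huv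

lemma div_add_div_le_eight_mul (hsr : s + 1 < r) (hL : 0 < L) (hLt : L ≤ 4 * (t * r))
    (hst : s ≤ (t + 1) * (r - (s + 1))) :
    (L : ℝ) / r + r / ((r : ℝ) - (s + 1)) ≤ 8 * t := by
  obtain ⟨w, rfl⟩ := Nat.exists_eq_add_of_le hsr.le
  have hwr : ((s + 1 + w : ℕ) : ℝ) - (s + 1) = w := by push_cast; ring
  rw [Nat.add_sub_cancel_left] at hst
  have hw : 1 ≤ w := by omega
  have ht : 1 ≤ t := Nat.pos_of_ne_zero fun h => by rw [h] at hLt; omega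
  have hLr : (L : ℝ) / (s + 1 + w : ℕ) ≤ 4 * t := by
    rw [div_le_iff₀ (by positivity), mul_assoc]
    exact_mod_cast hLt
  have hrw : ((s + 1 + w : ℕ) : ℝ) / w ≤ 4 * t := by
    rw [div_le_iff₀ (by positivity)]
    exact_mod_cast (by nlinarith : s + 1 + w ≤ 4 * t * w)
  rw [hwr]
  linarith

end LowerBound

theorem mainTheorem6 (d : ℕ) (hd : 1 ≤ d) :
    ∃ c C : ℝ, 0 < c ∧ 0 < C ∧
      ∀ n L r s : ℕ, n = L ^ d → 1 ≤ s → s + 1 < r → 2 * r ≤ L →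
        ∀ src : LatticeNode d L,
          -- at the end of the algorithm every node has received the message
          (∀ v, v ∈ informed r s (algAd d L r s src) src (algAd d L r s src).length) ∧
          -- upper bound on the number of rounds of the algorithm
          ((algAd d L r s src).length : ℝ) ≤
            C * (d * (n : ℝ) ^ (1 / (d : ℝ)) / r + d * (r : ℝ) / ((r : ℝ) - (s + 1))) ∧
          -- lower bound on every number of rounds after which all nodes have received the message
          ∀ t : ℕ, (∀ v, v ∈ informed r s (algAd d L r s src) src t) →
            c * (d * (n : ℝ) ^ (1 / (d : ℝ)) / r + d * (r : ℝ) / ((r : ℝ) - (s + 1))) ≤ (t : ℝ) := by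
  have : NeZero d := ⟨by omega⟩
  refine ⟨1 / (8 * d), 25 * (3 * d) ^ d, by positivity, by positivity, ?_⟩
  rintro n L r s rfl - hsr hrL src
  have hroot : ((L ^ d : ℕ) : ℝ) ^ (1 / (d : ℝ)) = L := by
    rw [Nat.cast_pow, one_div, Real.pow_rpow_inv_natCast (Nat.cast_nonneg L) (NeZero.ne d)]
  rw [hroot, mul_div_assoc, mul_div_assoc, ← mul_add]
  refine ⟨mem_informed_algAd hsr hrL src, length_algAd_le hsr src, fun t ht => ?_⟩
  have hdist := le_four_mul_of_forall_mem_informed (by omega) ht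
  have hswamp := le_add_one_mul_of_forall_mem_informed hsr hrL ht
  have hbound := div_add_div_le_eight_mul hsr (by omega) hdist hswamp
  calc 1 / (8 * (d : ℝ)) * (d * ((L : ℝ) / r + r / ((r : ℝ) - (s + 1))))
      = ((L : ℝ) / r + r / ((r : ℝ) - (s + 1))) / 8 := by field_simp
    _ ≤ t := by linarith
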